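/- Let $G$ be a (real) Lie group, $V$ an $n$-dimensional real vector space, and $\Phi:G\to \mathrm{Aut}(V)$ a representation, i.e. a smooth group homomorphism. Equip the tangent bundle $TV$ with the $2n$-dimensional vector space structure $$X\oplus Y=(T\tau_y)X+(T\tau_x)Y,\qquad \lambda\bullet X=(T\sigma_\lambda)X\qquad (X\in T_xV,\ Y\in T_yV,\ \lambda\in\mathbb{R}),$$ where $\tau_x$ is the translation by $x$ and $\sigma_\lambda$ the multiplication by $\lambda$ on $V$. Fix a basis $\alpha_1,\dots,\alpha_n$ of $V$ with coordinate functions $x_1,\dots,x_n$, let $\psi:TV\to V\times\mathbb{R}^n$, $\psi(Y_p)=(p,(Y_p[x_1],\dots,Y_p[x_n]))$ for $Y_p\in T_pV$, be the induced linear trivialization, and give $TV$ the basis $\psi^{-1}(\alpha_1,0),\dots,\psi^{-1}(\alpha_n,0),\psi^{-1}(0,e_1),\dots,\psi^{-1}(0,e_n)$. Let $Z:\mathrm{Aut}(V)\to GL(n,\mathbb{R})$ and $\breve Z:\mathrm{Aut}(TV)\to GL(2n,\mathbb{R})$ be the isomorphisms that send an automorphism to its matrix in these bases, and let $$J_n:T(GL(n,\mathbb{R}))\to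 GL(2n,\mathbb{R}),\qquad J_n(Y)=\begin{pmatrix} a&0\\ Ba&a\end{pmatrix}\quad\text{for } Y\in T_aGL(n,\mathbb{R}),\ B=TR_{a^{-1}}(Y)\in \mathrm{Lie}(GL(n,\mathbb{R})),$$ with $R_{a^{-1}}$ the right translation by $a^{-1}$. The prolongation of $\Phi$ is $\widetilde\Phi=\breve Z^{-1}\circ J_n\circ TZ\circ T\Phi:TG\to \mathrm{Aut}(TV)$. Let $U\subseteq V$ be a linear subspace, and regard $TU$ as a linear subspace of $TV$ through the differential of the inclusion $U\hookrightarrow V$. Then $U$ is invariant for $\Phi$ (that is, $\Phi(a)(U)\subseteq U$ for all $a\in G$) if and only if $TU$ is invariant for $\widetilde\Phi$ (that is, $\widetilde\Phi(X)(TU)\subseteq TU$ for all $X\in TG$). -/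

import Mathlib

open scoped Manifold ContDiff Bundle

noncomputable section

namespace Prolongation

instance completeSpace_end {V : Type*} [NormedAddCommGroup V] [NormedSpace ℝ V]
    [FiniteDimensional ℝ V] : CompleteSpace (V →L[ℝ] V) :=
  FiniteDimensional.complete ℝ _

/-- The algebra of real `n × n` matrices, as a type of its own, to be equipped with a norm. -/
def Mat (n : ℕ) : Type := Matrix (Fin n) (Fin n) ℝ

/-- The `ℓ^∞` operator norm on matrices; the choice of a norm does not affect the smooth
structure on `GL(n, ℝ)`. -/
instance (n : ℕ) : NormedRing (Mat n) :=
  (Matrix.linftyOpNormedRing : NormedRing (Matrix (Fin n) (Fin n) ℝ))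

instance (n : ℕ) : NormedAlgebra ℝ (Mat n) :=
  letI : NormedRing (Matrix (Fin n) (Fin n) ℝ) := Matrix.linftyOpNormedRing
  (Matrix.linftyOpNormedAlgebra : NormedAlgebra ℝ (Matrix (Fin n) (Fin n) ℝ))

instance (n : ℕ) : FiniteDimensional ℝ (Mat n) :=
  (inferInstance : FiniteDimensional ℝ (Matrix (Fin n) (Fin n) ℝ))

instance (n : ℕ) : CompleteSpace (Mat n) :=
  FiniteDimensional.complete ℝ _

/-- The identity map from matrices to `Mat n`. -/
def toMat (n : ℕ) : Matrix (Fin n) (Fin n) ℝ ≃* Mat n where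
  toFun A := A
  invFun A := A
  left_inv _ := rfl
  right_inv _ := rfl
  map_mul' _ _ := rfl

/-- The Lie group `GL(n, ℝ)`, an open subset of the space of matrices. -/
abbrev GLn (n : ℕ) : Type := (Mat n)ˣ

/-- The tangent bundle `TV` of a normed space `V`, seen as a manifold. -/
abbrev TV (V : Type*) [NormedAddCommGroup V] [NormedSpace ℝ V] : Type _ :=
  TangentBundle 𝓘(ℝ, V) V

/-- The automorphism group `Aut(V)` of a finite-dimensional real vector space, with its Lie group
structure as an open subset of the space of endomorphisms (all of them are continuous). -/
abbrev Aut (V : Type*) [NormedAddCommGroup V] [NormedSpace ℝ V] : Type _ :=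
  (V →L[ℝ] V)ˣ

section VectorSpaceStructure

variable {V : Type*} [NormedAddCommGroup V] [NormedSpace ℝ V]

/-- `X ⊕ Y = (Tτ_y) X + (Tτ_x) Y` for `X ∈ T_x V` and `Y ∈ T_y V`, with `τ` the translations;
the sum on the right is taken in `T_{x+y} V`. -/
instance : Add (TV V) where
  add X Y := ⟨X.proj + Y.proj, HAdd.hAdd (α := TangentSpace 𝓘(ℝ, V) (X.proj + Y.proj))
    (mfderiv 𝓘(ℝ, V) 𝓘(ℝ, V) (fun z : V => z + Y.proj) X.proj X.snd)
    (mfderiv 𝓘(ℝ, V) 𝓘(ℝ, V) (fun z : V => X.proj + z) Y.proj Y.snd)⟩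

/-- `c • X = (Tσ_c) X`, with `σ_c` the scalar multiplication by `c` on `V`. -/
instance : SMul ℝ (TV V) where
  smul c X := tangentMap 𝓘(ℝ, V) 𝓘(ℝ, V) (fun z : V => c • z) X

/-- The zero vector of `TV`: the zero tangent vector at the origin. -/
instance : Zero (TV V) where
  zero := ⟨0, (0 : V)⟩

/-- The opposite of `X` is `(Tσ_{-1}) X`. -/
instance : Neg (TV V) where
  neg X := (-1 : ℝ) • X

/-- The principal part of a tangent vector of `V`. -/
def vec (X : TV V) : V := X.snd

theorem add_def (X Y : TV V) : X + Y = ⟨X.proj + Y.proj, vec X + vec Y⟩ := by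
  change (⟨X.proj + Y.proj, _⟩ : TV V) = _
  congr 1
  rw [mfderiv_eq_fderiv, mfderiv_eq_fderiv, fderiv_add_const, fderiv_const_add]
  simp
  rfl

theorem smul_def (c : ℝ) (X : TV V) :
    c • X = ⟨c • X.proj, c • vec X⟩ := by
  change (⟨c • X.proj, mfderiv 𝓘(ℝ, V) 𝓘(ℝ, V) (fun z : V => c • z) X.proj X.snd⟩ : TV V) = _
  congr 1
  rw [mfderiv_eq_fderiv]
  have h : HasFDerivAt (fun z : V => c • z) (c • ContinuousLinearMap.id ℝ V) X.proj :=
    (hasFDerivAt_id X.proj).const_smul c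
  rw [h.fderiv]
  rfl

/-- The bijection `TV ≃ V × V`, used to verify the vector space axioms. -/
def toProd : TV V ≃ V × V where
  toFun X := (X.proj, X.snd)
  invFun q := ⟨q.1, q.2⟩
  left_inv _ := rfl
  right_inv _ := rfl

theorem toProd_add (X Y : TV V) : toProd (X + Y) = toProd X + toProd Y := by
  rw [add_def]; rfl

theorem toProd_smul (c : ℝ) (X : TV V) : toProd (c • X) = c • toProd X := by
  rw [smul_def]; rfl

theorem toProd_zero : toProd (0 : TV V) = 0 := rfl

theorem toProd_neg (X : TV V) : toProd (-X) = -toProd X := by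
  change toProd ((-1 : ℝ) • X) = _
  rw [toProd_smul, neg_one_smul]

instance : AddCommGroup (TV V) where
  add_assoc X Y Z := toProd.injective (by simp only [toProd_add, add_assoc])
  zero_add X := toProd.injective (by simp only [toProd_add, toProd_zero, zero_add])
  add_zero X := toProd.injective (by simp only [toProd_add, toProd_zero, add_zero])
  nsmul := nsmulRec
  zsmul := zsmulRec
  neg_add_cancel X := toProd.injective (by
    simp only [toProd_add, toProd_neg, toProd_zero, neg_add_cancel])
  add_comm X Y := toProd.injective (by simp only [toProd_add, add_comm])

/-- The `2n`-dimensional vector space structure on the tangent bundle `TV`. -/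
instance : Module ℝ (TV V) where
  one_smul X := toProd.injective (by simp only [toProd_smul, one_smul])
  mul_smul c d X := toProd.injective (by simp only [toProd_smul, mul_smul])
  smul_zero c := toProd.injective (by simp only [toProd_smul, toProd_zero, smul_zero])
  smul_add c X Y := toProd.injective (by simp only [toProd_smul, toProd_add, smul_add])
  add_smul c d X := toProd.injective (by simp only [toProd_smul, toProd_add, add_smul])
  zero_smul X := toProd.injective (by simp only [toProd_smul, toProd_zero, zero_smul])

/-- The differential of a continuous linear map `f : V → W` is linear from `TV` to `TW`. -/
def tangentLinearMap {W : Type*} [NormedAddCommGroup W] [NormedSpace ℝ W] (f : V →L[ℝ] W) :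
    TV V →ₗ[ℝ] TV W where
  toFun := tangentMap 𝓘(ℝ, V) 𝓘(ℝ, W) f
  map_add' X Y := toProd.injective (by
    rw [toProd_add, add_def]
    simp only [tangentMap, mfderiv_eq_fderiv, ContinuousLinearMap.fderiv]
    exact Prod.ext (map_add f _ _) (map_add f _ _))
  map_smul' c X := toProd.injective (by
    rw [toProd_smul, smul_def]
    simp only [tangentMap, mfderiv_eq_fderiv, ContinuousLinearMap.fderiv]
    exact Prod.ext (map_smul f _ _) (map_smul f _ _))

/-- The tangent bundle `TU` of a subspace `U ⊆ V`, seen as a subspace of `TV` through the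
differential of the inclusion `U → V`. -/
def tangentSubspace (U : Submodule ℝ V) : Submodule ℝ (TV V) :=
  LinearMap.range (tangentLinearMap U.subtypeL)

end VectorSpaceStructure

/-- A subspace `U` is invariant for a family `Ψ` of linear operators (for instance for a
representation) if all of these operators map `U` into itself. -/
def IsInvariantSubspace {S W : Type*} [AddCommGroup W] [Module ℝ W] (Ψ : S → (W →ₗ[ℝ] W))
    (U : Submodule ℝ W) : Prop :=
  ∀ s : S, ∀ p ∈ U, Ψ s p ∈ U

section Prolong

variable {n : ℕ} {V : Type*} [NormedAddCommGroup V] [NormedSpace ℝ V] [FiniteDimensional ℝ V]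

/-- The derivative `X[x_i]` of the `i`-th coordinate function of `V` in the basis `b` along the
tangent vector `X`. -/
def coordDeriv (b : Module.Basis (Fin n) ℝ V) (X : TV V) (i : Fin n) : ℝ :=
  mfderiv 𝓘(ℝ, V) 𝓘(ℝ, ℝ) (fun p : V => b.repr p i) X.proj X.snd

theorem coordDeriv_eq (b : Module.Basis (Fin n) ℝ V) (X : TV V) :
    coordDeriv b X = b.equivFun (vec X) := by
  funext i
  have h : (fun p : V => b.repr p i) = (b.coord i).toContinuousLinearMap := rfl
  rw [coordDeriv, mfderiv_eq_fderiv, h, ContinuousLinearMap.fderiv]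
  rfl

/-- The bundle trivialization `ψ : TV → V × ℝⁿ`, `Y_p ↦ (p, (Y_p[x_1], …, Y_p[x_n]))`, where
`x_1, …, x_n` are the coordinate functions of `V` in the basis `b`. -/
def psi (b : Module.Basis (Fin n) ℝ V) : TV V ≃ₗ[ℝ] V × (Fin n → ℝ) where
  toFun X := (X.proj, coordDeriv b X)
  invFun q := ⟨q.1, b.equivFun.symm q.2⟩
  map_add' X Y := by
    simp only [coordDeriv_eq, add_def]
    exact Prod.ext rfl (map_add b.equivFun (vec X) (vec Y))
  map_smul' c X := by
    simp only [coordDeriv_eq, smul_def]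
    exact Prod.ext rfl (map_smul b.equivFun c (vec X))
  left_inv X := by
    simp only [coordDeriv_eq, LinearEquiv.symm_apply_apply]
    rfl
  right_inv q := by
    simp only [coordDeriv_eq]
    exact Prod.ext rfl (b.equivFun.apply_symm_apply q.2)

/-- The basis `(α̃_1, …, α̃_n, ỹ_1, …, ỹ_n)` of `TV` with `α̃_i = ψ⁻¹(α_i, 0)` and
`ỹ_i = ψ⁻¹(0, e_i)`, where `b = (α_1, …, α_n)`. -/
def tangentBasis (b : Module.Basis (Fin n) ℝ V) : Module.Basis (Fin n ⊕ Fin n) ℝ (TV V) :=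
  (b.prod (Pi.basisFun ℝ (Fin n))).map (psi b).symm

/-- The isomorphism `Z : Aut(V) → GL(n, ℝ)` sending an automorphism to its matrix in the
basis `b`. -/
def Z (b : Module.Basis (Fin n) ℝ V) : Aut V →* GLn n :=
  Units.map (((toMat n).toMonoidHom.comp
    (LinearMap.toMatrixAlgEquiv b).toMulEquiv.toMonoidHom).comp
    ((ContinuousLinearMap.toLinearMapRingHom : (V →L[ℝ] V) →+* (V →ₗ[ℝ] V)) :
      (V →L[ℝ] V) →* (V →ₗ[ℝ] V)))

/-- The isomorphism `Z̆ : Aut(TV) → GL(2n, ℝ)` sending an automorphism of `TV` to its matrix in the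
basis `tangentBasis b`. -/
def Zbreve (b : Module.Basis (Fin n) ℝ V) :
    LinearMap.GeneralLinearGroup ℝ (TV V) ≃* GL (Fin n ⊕ Fin n) ℝ :=
  Units.mapEquiv (LinearMap.toMatrixAlgEquiv (tangentBasis b)).toMulEquiv

/-- For `Y ∈ T_a GL(n, ℝ)`, the element `B = TR_{a⁻¹}(Y)` of `Lie(GL(n, ℝ))`, so that
`Y = [a, B]`. As `GL(n, ℝ)` is open in the space of matrices, `B` is a matrix. -/
def lieComponent (Y : TangentBundle 𝓘(ℝ, Mat n) (GLn n)) : Mat n :=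
  mfderiv 𝓘(ℝ, Mat n) 𝓘(ℝ, Mat n) (fun y : GLn n => y * Y.proj⁻¹) Y.proj Y.snd

/-- The embedding `J_n : T(GL(n, ℝ)) → GL(2n, ℝ)` sending `[a, B]` to the block matrix with rows
`(a, 0)` and `(B a, a)`. -/
def J (Y : TangentBundle 𝓘(ℝ, Mat n) (GLn n)) : GL (Fin n ⊕ Fin n) ℝ where
  val := Matrix.fromBlocks ((toMat n).symm Y.proj.val) 0
    ((toMat n).symm (lieComponent Y * Y.proj.val)) ((toMat n).symm Y.proj.val)
  inv := Matrix.fromBlocks ((toMat n).symm Y.proj.inv) 0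
    (-(toMat n).symm (Y.proj.inv * lieComponent Y)) ((toMat n).symm Y.proj.inv)
  val_inv := by
    have h : (toMat n).symm Y.proj.val * (toMat n).symm Y.proj.inv = 1 := by
      rw [← map_mul, Y.proj.val_inv, map_one]
    rw [Matrix.fromBlocks_multiply, map_mul, map_mul]
    simp only [Matrix.mul_neg, ← Matrix.mul_assoc, h]
    rw [Matrix.mul_assoc _ _ ((toMat n).symm Y.proj.inv), h]
    simp [Matrix.fromBlocks_one]
  inv_val := by
    have h : (toMat n).symm Y.proj.inv * (toMat n).symm Y.proj.val = 1 := by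
      rw [← map_mul, Y.proj.inv_val, map_one]
    rw [Matrix.fromBlocks_multiply, map_mul, map_mul]
    simp only [Matrix.neg_mul, ← Matrix.mul_assoc, h]
    simp [Matrix.fromBlocks_one]

/-- The prolongation `Φ̃ = Z̆⁻¹ ∘ J_n ∘ TZ ∘ TΦ : TG → Aut(TV)` of a representation
`Φ : G → Aut(V)`. -/
def prolongation {E : Type*} [NormedAddCommGroup E] [NormedSpace ℝ E] {H : Type*}
    [TopologicalSpace H] {I : ModelWithCorners ℝ E H} {G : Type*} [TopologicalSpace G]
    [ChartedSpace H G] [Group G] (b : Module.Basis (Fin n) ℝ V)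
    (Φ : ContMDiffMonoidMorphism I 𝓘(ℝ, V →L[ℝ] V) ∞ G (Aut V)) (X : TangentBundle I G) :
    LinearMap.GeneralLinearGroup ℝ (TV V) :=
  (Zbreve b).symm (J (tangentMap 𝓘(ℝ, V →L[ℝ] V) 𝓘(ℝ, Mat n) (Z b)
    (tangentMap I 𝓘(ℝ, V →L[ℝ] V) Φ X)))

end Prolong

end Prolongation

end

namespace Prolongation

/-! ### Differentials on the group of units of a normed algebra -/

section Units

variable {R : Type*} [NormedRing R] [NormedAlgebra ℝ R] [CompleteSpace R]
  {E : Type*} [NormedAddCommGroup E] [NormedSpace ℝ E] {H : Type*} [TopologicalSpace H]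
  {I : ModelWithCorners ℝ E H} {M : Type*} [TopologicalSpace M] [ChartedSpace H M]

/-! Identify `TV` with `V × V` by base point and principal part; then `TU` becomes `U × U`. Let `X`
lie over `a` and read `TΦ(X)` as an endomorphism `Y` of `V`. Since `Z` is the restriction of a
linear map and `B` is the matrix of `Y` times the inverse of that of `Φ(a)`, the lower left block of
the `J` matrix is just the matrix of `Y`. Hence `Φ̃(X)` sends `(p, v)` to `(Φ(a) p, Y p + Φ(a) v)`,
which is `Zbreve_symm_J_tangentMap_Z`. If `U` is invariant and `p ∈ U`, the map `g ↦ Φ(g) p` takes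
values in `U`, hence so does its derivative `Y p` (`mfderiv_apply_mem`), and both components stay in
`U`. Conversely, the first component of the formula gives back the invariance under `Φ(a)`. -/

/-- The principal part of a tangent vector of the group of units, an element of the algebra. -/
def unitsVec (Y : TangentBundle 𝓘(ℝ, R) Rˣ) : R := Y.snd

/-- In the open embedding chart, the inclusion of the units has the identity as differential. -/
theorem hasMFDerivAt_units_val (x : Rˣ) :
    HasMFDerivAt 𝓘(ℝ, R) 𝓘(ℝ, R) (Units.val : Rˣ → R) x (ContinuousLinearMap.id ℝ R) := by
  refine ⟨Units.continuous_val.continuousAt, ?_⟩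
  have hx : (extChartAt 𝓘(ℝ, R) x) x = (x : R) := rfl
  rw [hx]
  -- The chart is the inclusion itself, so in coordinates the map is the inclusion after its local
  -- inverse: the identity on the set of units, which is an open neighbourhood of `x`.
  refine HasFDerivWithinAt.congr_of_eventuallyEq (hasFDerivWithinAt_id (x : R) _) ?_ ?_
  · have : Set.range (Units.val : Rˣ → R) ∈ nhds (x : R) :=
      Units.isOpenEmbedding_val.isOpen_range.mem_nhds ⟨x, rfl⟩
    filter_upwards [mem_nhdsWithin_of_mem_nhds this]
    rintro _ ⟨y, rfl⟩
    exact congrArg Units.val ((extChartAt 𝓘(ℝ, R) x).left_inv (x := y) (by simp))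
  · exact congrArg Units.val ((extChartAt 𝓘(ℝ, R) x).left_inv (x := x) (by simp))

/-- The differential of a map into the units is that of the underlying map into the algebra. -/
theorem mfderiv_units_val_comp {f : M → Rˣ} {x : M} (hf : MDifferentiableAt I 𝓘(ℝ, R) f x) :
    (mfderiv I 𝓘(ℝ, R) (fun y => (f y : R)) x : E →L[ℝ] R) = mfderiv I 𝓘(ℝ, R) f x :=
  ((hasMFDerivAt_units_val (f x)).comp x hf.hasMFDerivAt).mfderiv

/-- A map between groups of units that is the restriction of a continuous linear map `L` has
differential `L`. -/
theorem mfderiv_units_of_comp_val_eq {S : Type*} [NormedRing S] [NormedAlgebra ℝ S]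
    [CompleteSpace S] (f : Rˣ → Sˣ) (L : R →L[ℝ] S) (h : ∀ x, (f x : S) = L x) (x : Rˣ) :
    (mfderiv 𝓘(ℝ, R) 𝓘(ℝ, S) f x : R →L[ℝ] S) = L := by
  have hval : (fun y => (f y : S)) = L ∘ Units.val := funext h
  have hf : ContMDiff 𝓘(ℝ, R) 𝓘(ℝ, S) ∞ f := by
    -- Smoothness into the units can be tested after the open embedding into `S`, where `f` becomes
    -- `L` restricted to units.
    apply ContMDiff.of_comp_isOpenEmbedding Units.isOpenEmbedding_val
    change ContMDiff _ _ _ (fun y => (f y : S))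
    rw [hval]
    exact L.contMDiff.comp Units.contMDiff_val
  have hd := hf.mdifferentiableAt (by simp) (x := x)
  rw [← mfderiv_units_val_comp hd, hval]
  exact (L.hasMFDerivAt.comp x (hasMFDerivAt_units_val x)).mfderiv

end Units

/-! ### The prolonged operators in coordinates -/

section Prolong

variable {n : ℕ} {V : Type*} [NormedAddCommGroup V] [NormedSpace ℝ V]

/-- Right translation by `a⁻¹` is the restriction of a linear map, so `B = Y a⁻¹` and the factor `a`
in `B a` cancels. This removes the Lie algebra trivialization from the block matrix `J`. -/
theorem lieComponent_mul_val (Y : TangentBundle 𝓘(ℝ, Mat n) (GLn n)) :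
    lieComponent Y * Y.proj.val = unitsVec Y := by
  have h := mfderiv_units_of_comp_val_eq (fun y : GLn n => y * Y.proj⁻¹)
    ((ContinuousLinearMap.mul ℝ (Mat n)).flip (Y.proj⁻¹ : GLn n)) (fun _ => rfl) Y.proj
  have h' : lieComponent Y = unitsVec Y * (Y.proj⁻¹ : GLn n) :=
    DFunLike.congr_fun h (unitsVec Y)
  rw [h', mul_assoc, Units.inv_mul, mul_one]

/-- The inclusion of `U` is linear, hence its own differential at every point; so `TU` is `U × U`.
-/
theorem mem_tangentSubspace {U : Submodule ℝ V} {P : TV V} :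
    P ∈ tangentSubspace U ↔ P.proj ∈ U ∧ vec P ∈ U := by
  have key (Q : TV U) : tangentLinearMap U.subtypeL Q =
      (⟨(Q.proj : V), ((vec Q : U) : V)⟩ : TV V) := by
    change tangentMap 𝓘(ℝ, U) 𝓘(ℝ, V) U.subtypeL Q = _
    simp only [tangentMap, mfderiv_eq_fderiv, ContinuousLinearMap.fderiv]
    rfl
  constructor
  · rintro ⟨Q, rfl⟩
    rw [key]
    exact ⟨Q.proj.2, (vec Q).2⟩
  · rintro ⟨h₁, h₂⟩
    exact ⟨⟨⟨P.proj, h₁⟩, (⟨vec P, h₂⟩ : U)⟩, key _⟩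

variable [FiniteDimensional ℝ V]

theorem tangentBasis_repr (b : Module.Basis (Fin n) ℝ V) (P : TV V) :
    ⇑((tangentBasis b).repr P) = Sum.elim (b.repr P.proj) (b.repr (vec P)) := by
  have h : psi b P = (P.proj, b.equivFun (vec P)) := by rw [← coordDeriv_eq]; rfl
  funext i
  rcases i with i | i <;> simp [tangentBasis, h]

/-- The differential at any point of the matrix isomorphism `Z`, as a linear map. -/
noncomputable def matrixCLM (b : Module.Basis (Fin n) ℝ V) : (V →L[ℝ] V) →L[ℝ] Mat n :=
  LinearMap.toContinuousLinearMap
    { toFun := fun T => toMat n (LinearMap.toMatrix b b (T : V →ₗ[ℝ] V))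
      map_add' := fun S T => by
        exact (LinearMap.toMatrix b b).map_add (S : V →ₗ[ℝ] V) (T : V →ₗ[ℝ] V)
      map_smul' := fun c T => by
        exact (LinearMap.toMatrix b b).map_smul c (T : V →ₗ[ℝ] V) }

theorem matrixCLM_apply (b : Module.Basis (Fin n) ℝ V) (T : V →L[ℝ] V) :
    (toMat n).symm (matrixCLM b T) = LinearMap.toMatrix b b (T : V →ₗ[ℝ] V) := rfl

theorem Z_val (b : Module.Basis (Fin n) ℝ V) (a : Aut V) :
    (Z b a : Mat n) = matrixCLM b (a : V →L[ℝ] V) := rfl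

/-- The operator `Z̆⁻¹ (J (TZ Y))` attached to `Y ∈ T_a Aut(V)` maps `(p, v)` to
`(a p, Y p + a v)`. -/
theorem Zbreve_symm_J_tangentMap_Z (b : Module.Basis (Fin n) ℝ V)
    (Y : TangentBundle 𝓘(ℝ, V →L[ℝ] V) (Aut V)) (P : TV V) :
    ((Zbreve b).symm (J (tangentMap 𝓘(ℝ, V →L[ℝ] V) 𝓘(ℝ, Mat n) (Z b) Y)) :
        TV V →ₗ[ℝ] TV V) P =
      (⟨(Y.proj : V →L[ℝ] V) P.proj,
        HAdd.hAdd (α := V) (unitsVec Y P.proj) ((Y.proj : V →L[ℝ] V) (vec P))⟩ : TV V) := by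
  set W := tangentMap 𝓘(ℝ, V →L[ℝ] V) 𝓘(ℝ, Mat n) (Z b) Y
  have hproj : (W.proj : Mat n) = matrixCLM b (Y.proj : V →L[ℝ] V) := rfl
  have hsnd : unitsVec W = matrixCLM b (unitsVec Y) :=
    DFunLike.congr_fun (mfderiv_units_of_comp_val_eq (Z b) (matrixCLM b) (Z_val b) Y.proj)
      (unitsVec Y)
  have hJ : (J W : Matrix (Fin n ⊕ Fin n) (Fin n ⊕ Fin n) ℝ) =
      Matrix.fromBlocks (LinearMap.toMatrix b b ((Y.proj : V →L[ℝ] V) : V →ₗ[ℝ] V)) 0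
        (LinearMap.toMatrix b b ((unitsVec Y : V →L[ℝ] V) : V →ₗ[ℝ] V))
        (LinearMap.toMatrix b b ((Y.proj : V →L[ℝ] V) : V →ₗ[ℝ] V)) := by
    change Matrix.fromBlocks _ _ _ _ = _
    rw [lieComponent_mul_val, hproj, hsnd, matrixCLM_apply, matrixCLM_apply]
  have hlin : ((Zbreve b).symm (J W) : TV V →ₗ[ℝ] TV V) =
      Matrix.toLin (tangentBasis b) (tangentBasis b) (J W) := rfl
  -- Compare coordinates: the block matrix acts on the column of the coordinates of `p` and `v`.
  apply (tangentBasis b).repr.injective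
  apply DFunLike.coe_injective
  rw [hlin, Matrix.repr_toLin, hJ, tangentBasis_repr, tangentBasis_repr, Matrix.fromBlocks_mulVec]
  simp only [Sum.elim_comp_inl, Sum.elim_comp_inr, Matrix.zero_mulVec, add_zero,
    LinearMap.toMatrix_mulVec_repr]
  congr 1
  exact (congrArg DFunLike.coe (map_add b.repr (unitsVec Y P.proj)
    ((Y.proj : V →L[ℝ] V) (vec P)))).symm

end Prolong

/-! ### Invariant subspaces -/

variable {E : Type*} [NormedAddCommGroup E] [NormedSpace ℝ E]
    {H : Type*} [TopologicalSpace H] {I : ModelWithCorners ℝ E H}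
    {G : Type*} [TopologicalSpace G] [ChartedSpace H G]
    {V : Type*} [NormedAddCommGroup V] [NormedSpace ℝ V] [FiniteDimensional ℝ V]

/-- If all values of a differentiable map into `Aut(V)` preserve `U`, so do its derivatives. -/
theorem mfderiv_apply_mem {f : G → Aut V} {g : G}
    (hf : MDifferentiableAt I 𝓘(ℝ, V →L[ℝ] V) f g) {U : Submodule ℝ V} {p : V}
    (h : ∀ a, (f a : V →L[ℝ] V) p ∈ U) (v : TangentSpace I g) :
    unitsVec (tangentMap I 𝓘(ℝ, V →L[ℝ] V) f ⟨g, v⟩) p ∈ U := by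
  -- Otherwise some functional `l` vanishes on `U` but not at the derivative. Then `T ↦ l (T p)` is
  -- linear and vanishes along `f`, so by the chain rule it kills the derivative of `f`, a
  -- contradiction.
  by_contra hmem
  obtain ⟨l, hl, hU⟩ := U.exists_le_ker_of_notMem hmem
  let L : (V →L[ℝ] V) →L[ℝ] ℝ :=
    l.toContinuousLinearMap.comp (ContinuousLinearMap.apply ℝ V p)
  have hzero : L ∘ (fun a => (f a : V →L[ℝ] V)) = fun _ => (0 : ℝ) :=
    funext fun a => hU (h a)
  have hd := L.hasMFDerivAt.comp g ((hasMFDerivAt_units_val (f g)).comp g hf.hasMFDerivAt)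
  have hd0 := hasMFDerivAt_unique hd (hzero ▸ hasMFDerivAt_const (0 : ℝ) g)
  exact hl (DFunLike.congr_fun hd0 v)

end Prolongation

/-- Let `Φ : G → Aut(V)` be a finite-dimensional real representation of a Lie group and `Φ̃` its
prolongation to `TG`. A subspace `U` of `V` is invariant for `Φ` if and only if `TU` is an invariant
subspace of `TV` for `Φ̃`. -/
theorem proposition3p9 {E : Type*} [NormedAddCommGroup E] [NormedSpace ℝ E]
    {H : Type*} [TopologicalSpace H] {I : ModelWithCorners ℝ E H}
    {G : Type*} [TopologicalSpace G] [ChartedSpace H G] [Group G] [LieGroup I ∞ G]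
    {V : Type*} [NormedAddCommGroup V] [NormedSpace ℝ V] [FiniteDimensional ℝ V]
    {n : ℕ} (b : Module.Basis (Fin n) ℝ V)
    (Φ : ContMDiffMonoidMorphism I 𝓘(ℝ, V →L[ℝ] V) ∞ G (Prolongation.Aut V))
    (U : Submodule ℝ V) :
    Prolongation.IsInvariantSubspace (fun a : G => ((Φ a : V →L[ℝ] V) : V →ₗ[ℝ] V)) U ↔
      Prolongation.IsInvariantSubspace
        (fun X : TangentBundle I G =>
          (Prolongation.prolongation b Φ X : Prolongation.TV V →ₗ[ℝ] Prolongation.TV V))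
        (Prolongation.tangentSubspace U) := by
  have hval (X : TangentBundle I G) (P : Prolongation.TV V) :=
    Prolongation.Zbreve_symm_J_tangentMap_Z b (tangentMap I 𝓘(ℝ, V →L[ℝ] V) Φ X) P
  constructor
  · intro h X P hP
    obtain ⟨hp, hv⟩ := Prolongation.mem_tangentSubspace.1 hP
    refine Prolongation.mem_tangentSubspace.2 ?_
    change (((Prolongation.Zbreve b).symm _ : Prolongation.TV V →ₗ[ℝ] Prolongation.TV V) P).proj
      ∈ U ∧ Prolongation.vec
        (((Prolongation.Zbreve b).symm _ : Prolongation.TV V →ₗ[ℝ] Prolongation.TV V) P) ∈ U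
    rw [hval]
    have hΦ : MDifferentiableAt I 𝓘(ℝ, V →L[ℝ] V) Φ X.proj :=
      Φ.contMDiff_toFun.mdifferentiableAt (by simp)
    -- For the term `Y p`, the point `p` stays fixed while the group element varies.
    exact ⟨h _ _ hp, U.add_mem (Prolongation.mfderiv_apply_mem hΦ (fun a => h a _ hp) X.snd)
      (h _ _ hv)⟩
  · intro h a p hp
    -- Only the base point of the image matters, so zero is taken both for the tangent vector at `a`
    -- and for the principal part over `p`.
    have hP := h ⟨a, (0 : E)⟩ (⟨p, (0 : V)⟩ : Prolongation.TV V)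
      (Prolongation.mem_tangentSubspace.2 ⟨hp, U.zero_mem⟩)
    have hp' := (Prolongation.mem_tangentSubspace.1 hP).1
    change (((Prolongation.Zbreve b).symm _ : Prolongation.TV V →ₗ[ℝ] Prolongation.TV V) _).proj
      ∈ U at hp'
    rw [hval] at hp'
    exact hp'
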